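/- Let $\mathbb{A}_0=(0,1]\times\{0\}$, $\mathbb{A}_1=[0,1)\times\{1\}$, and let $\mathbb{A}=\mathbb{A}_0\cup\mathbb{A}_1$ be the Alexandroff--Urysohn double arrow space, that is, $\mathbb{A}$ carries the order topology of the lexicographic order ($\langle x,t\rangle<\langle y,s\rangle$ if and only if $x<y$, or $x=y$ and $t<s$). Let $\omega+1$ carry its order topology (a convergent sequence together with its limit). A topological space $X$ is called homogeneous if for all $x,y\in X$ there is a homeomorphism $h:X\to X$ with $h(x)=y$. It is called countable dense homogeneous (CDH) if it is separable and for all countable dense sets $D,E\subseteq X$ there is a homeomorphism $h:X\to X$ with $h[D]=E$. (1) $\mathbb{A}$ does not contain any subspace homeomorphic to $\mathbb{A}\times(\omega+1)$. (2) If $C$ is a compact, countably infinite Hausdorff space, then the product $C\times\mathbb{A}$ is neither homogeneous nor CDH. -/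

import Mathlib

/-- The underlying set of the double arrow space: `𝔸₀ ∪ 𝔸₁` with `𝔸₀ = (0,1] × {0}` and
`𝔸₁ = [0,1) × {1}`. It is a `def`, so that it inherits no topology from the plane. -/
def DoubleArrow : Type :=
  {p : ℝ ×ₗ Fin 2 //
    ((ofLex p).1 ∈ Set.Ioc (0 : ℝ) 1 ∧ (ofLex p).2 = 0) ∨
    ((ofLex p).1 ∈ Set.Ico (0 : ℝ) 1 ∧ (ofLex p).2 = 1)}

namespace DoubleArrow

/-- The lexicographic order. -/
noncomputable instance instLinearOrder : LinearOrder DoubleArrow :=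
  inferInstanceAs (LinearOrder {p : ℝ ×ₗ Fin 2 //
    ((ofLex p).1 ∈ Set.Ioc (0 : ℝ) 1 ∧ (ofLex p).2 = 0) ∨
    ((ofLex p).1 ∈ Set.Ico (0 : ℝ) 1 ∧ (ofLex p).2 = 1)})

/-- The order topology of the lexicographic order. -/
noncomputable instance instTopologicalSpace : TopologicalSpace DoubleArrow :=
  Preorder.topology DoubleArrow

instance instOrderTopology : OrderTopology DoubleArrow := ⟨rfl⟩

end DoubleArrow

/-- The space `ω + 1`: the naturals with a largest element added, in the order topology
(the topology that Mathlib puts on `ℕ∞`). -/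
abbrev OmegaPlusOne : Type := ℕ∞

/-- `X` is homogeneous: any point is moved to any other one by a homeomorphism of `X`. -/
def IsHomogeneous (X : Type*) [TopologicalSpace X] : Prop :=
  ∀ x y : X, ∃ h : X ≃ₜ X, h x = y

/-- `X` is countable dense homogeneous: it is separable, and any countable dense subset is mapped
onto any other one by a homeomorphism of `X`. -/
def IsCDH (X : Type*) [TopologicalSpace X] : Prop :=
  TopologicalSpace.SeparableSpace X ∧
    ∀ D E : Set X, D.Countable → Dense D → E.Countable → Dense E → ∃ h : X ≃ₜ X, h '' D = E

/-!
Write `lo r = ⟨r, 0⟩` and `hi r = ⟨r, 1⟩` for the two points above `r ∈ (0, 1)`. The topology of the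
double arrow space enters in two ways.

* A continuous real function `g` satisfies `g (lo r) = g (hi r)` for all but countably many `r`
  (`countable_jumps`), because the jumps over a fixed rational are isolated. Applied to the first
  coordinate of a continuous injection into `𝔸`, this says that for all but countably many `r` the
  images of `lo r` and `hi r` are again the two points above a single real.
* The two points above a real `s` form a jump of the order. Hence, if two such points `P c`, `Q c`
  converge to the two points above `s`, they are eventually equal to their limits
  (`eventually_eq_of_fst_eq`).

Let now `C` be a countable space with a non-isolated point `d`, and let `φ` be continuous and
injective from a neighbourhood of a point `(d, y)` of `C × 𝔸` to `𝔸`. As `C` is countable, one `r`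
serves for all `c ∈ C` in the first fact; by the second, `φ (c, lo r) = φ (d, lo r)` for all `c`
near `d`, which contradicts injectivity (`not_injOn_nhds`). With `C = ω + 1` this is the first
claim. It also shows that a homeomorphism of `C × 𝔸` cannot move a point `(c, x)` with `c`
isolated, which has `{c} × 𝔸` as a neighbourhood, to a point `(d, y)` with `d` not isolated. If
`C` is countably infinite, compact and Hausdorff, then it has points of both kinds and, by Baire's
theorem, its isolated points are dense. So `C × 𝔸` is not homogeneous; and it is not countable
dense homogeneous, since a countable dense set can be chosen among the points over isolated ones,
or with an additional point over a non-isolated one.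
-/

open Set Filter Topology

namespace DoubleArrow

/-! ### The order of the double arrow space -/

/-- The first coordinate, a point of `[0, 1]`. -/
def fst (p : DoubleArrow) : ℝ := (ofLex p.1).1

/-- The second coordinate. -/
def idx (p : DoubleArrow) : Fin 2 := (ofLex p.1).2

/-- The point `⟨r, 0⟩`. -/
def lo (r : Ioo (0 : ℝ) 1) : DoubleArrow :=
  ⟨toLex (r.1, 0), Or.inl ⟨⟨r.2.1, r.2.2.le⟩, rfl⟩⟩

/-- The point `⟨r, 1⟩`. -/
def hi (r : Ioo (0 : ℝ) 1) : DoubleArrow :=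
  ⟨toLex (r.1, 1), Or.inr ⟨⟨r.2.1.le, r.2.2⟩, rfl⟩⟩

@[simp] lemma idx_lo (r : Ioo (0 : ℝ) 1) : idx (lo r) = 0 := rfl
@[simp] lemma idx_hi (r : Ioo (0 : ℝ) 1) : idx (hi r) = 1 := rfl

lemma lt_iff {p q : DoubleArrow} :
    p < q ↔ fst p < fst q ∨ fst p = fst q ∧ idx p < idx q :=
  Prod.Lex.lt_iff (x := p.1) (y := q.1)

lemma eq_of_fst_of_idx {p q : DoubleArrow} (h : fst p = fst q) (h' : idx p = idx q) : p = q :=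
  Subtype.ext (ofLex.injective (Prod.ext h h'))

lemma fst_mem (p : DoubleArrow) : fst p ∈ Icc (0 : ℝ) 1 := by
  rcases p.2 with h | h
  · exact ⟨h.1.1.le, h.1.2⟩
  · exact ⟨h.1.1, h.1.2.le⟩

lemma idx_eq_zero_or_one (p : DoubleArrow) :
    idx p = 0 ∧ 0 < fst p ∨ idx p = 1 ∧ fst p < 1 := by
  rcases p.2 with h | h
  · exact Or.inl ⟨h.2, h.1.1⟩
  · exact Or.inr ⟨h.2, h.1.2⟩

lemma monotone_fst : Monotone fst := by
  intro p q h
  rcases h.eq_or_lt with rfl | h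
  · exact le_rfl
  · rcases lt_iff.1 h with h | h
    · exact h.le
    · exact h.1.le

/-- The first coordinate is a monotone map onto `[0, 1]`, hence continuous. -/
lemma continuous_fst : Continuous fst := by
  have hm : Monotone (fun p : DoubleArrow => (⟨fst p, fst_mem p⟩ : Icc (0 : ℝ) 1)) :=
    fun p q h => monotone_fst h
  have hs : Function.Surjective
      (fun p : DoubleArrow => (⟨fst p, fst_mem p⟩ : Icc (0 : ℝ) 1)) := by
    rintro ⟨x, h0, h1⟩
    rcases h0.eq_or_lt with rfl | h0
    · exact ⟨⟨toLex (0, 1), Or.inr ⟨⟨le_rfl, zero_lt_one⟩, rfl⟩⟩, rfl⟩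
    · exact ⟨⟨toLex (x, 0), Or.inl ⟨⟨h0, h1⟩, rfl⟩⟩, rfl⟩
  exact continuous_subtype_val.comp (hm.continuous_of_surjective hs)

lemma lo_lt_hi (r : Ioo (0 : ℝ) 1) : lo r < hi r := lt_iff.2 (Or.inr ⟨rfl, by simp⟩)

lemma idx_of_fst_eq_of_lt {p q : DoubleArrow} (h : fst p = fst q) (hlt : p < q) :
    idx p = 0 ∧ idx q = 1 := by
  have h1 : idx p < idx q := by
    rcases lt_iff.1 hlt with h' | h'
    · exact absurd h h'.ne
    · exact h'.2
  revert h1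
  generalize idx p = i
  generalize idx q = j
  revert i j
  decide

/-- The two points above a real form a jump of the order. -/
lemma covBy_of_fst_eq {p q : DoubleArrow} (h : fst p = fst q) (hlt : p < q) : p ⋖ q := by
  refine ⟨hlt, fun x hpx hxq => ?_⟩
  have h1 : fst p = fst x :=
    le_antisymm (monotone_fst hpx.le) (h ▸ monotone_fst hxq.le)
  have h2 := (idx_of_fst_eq_of_lt h1 hpx).2
  have h3 := (idx_of_fst_eq_of_lt (h1.symm.trans h) hxq).1
  simp [h2] at h3

/-- A neighbourhood of a point with second coordinate `1` contains all points above some interval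
to the right of it. -/
lemma exists_Ioo_right {p : DoubleArrow} (hp : idx p = 1) (hp1 : fst p < 1)
    {J : Set DoubleArrow} (hJ : J ∈ 𝓝 p) :
    ∃ b, fst p < b ∧ b ≤ 1 ∧ ∀ x, fst p < fst x → fst x < b → x ∈ J := by
  have hmax : p < (⟨toLex (1, 0), Or.inl ⟨⟨zero_lt_one, le_rfl⟩, rfl⟩⟩ : DoubleArrow) :=
    lt_iff.2 (Or.inl hp1)
  obtain ⟨u, hu, hsub⟩ := exists_Ico_subset_of_mem_nhds hJ ⟨_, hmax⟩
  refine ⟨fst u, ?_, (fst_mem u).2, fun x hx hxu =>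
    hsub ⟨(lt_iff.2 (Or.inl hx)).le, lt_iff.2 (Or.inl hxu)⟩⟩
  refine (monotone_fst hu.le).lt_of_ne fun h => ?_
  have := (idx_of_fst_eq_of_lt h hu).1
  simp [hp] at this

/-- A neighbourhood of a point with second coordinate `0` contains all points above some interval
to the left of it. -/
lemma exists_Ioo_left {p : DoubleArrow} (hp : idx p = 0) (hp0 : 0 < fst p)
    {J : Set DoubleArrow} (hJ : J ∈ 𝓝 p) :
    ∃ a, a < fst p ∧ 0 ≤ a ∧ ∀ x, a < fst x → fst x < fst p → x ∈ J := by
  have hmin : (⟨toLex (0, 1), Or.inr ⟨⟨le_rfl, zero_lt_one⟩, rfl⟩⟩ : DoubleArrow) < p :=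
    lt_iff.2 (Or.inl hp0)
  obtain ⟨l, hl, hsub⟩ := exists_Ioc_subset_of_mem_nhds hJ ⟨_, hmin⟩
  refine ⟨fst l, ?_, (fst_mem l).1, fun x hx hxu =>
    hsub ⟨lt_iff.2 (Or.inl hx), (lt_iff.2 (Or.inl hxu)).le⟩⟩
  refine (monotone_fst hl.le).lt_of_ne fun h => ?_
  have := (idx_of_fst_eq_of_lt h hl).2
  simp [hp] at this

lemma exists_Ioo_of_mem_nhds {p : DoubleArrow} {J : Set DoubleArrow} (hJ : J ∈ 𝓝 p) :
    ∃ a b : ℝ, 0 ≤ a ∧ a < b ∧ b ≤ 1 ∧ ∀ x, fst x ∈ Ioo a b → x ∈ J := by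
  rcases idx_eq_zero_or_one p with ⟨hp, h⟩ | ⟨hp, h⟩
  · obtain ⟨a, ha, h0, H⟩ := exists_Ioo_left hp h hJ
    exact ⟨a, fst p, h0, ha, (fst_mem p).2, fun x hx => H x hx.1 hx.2⟩
  · obtain ⟨b, hb, h1, H⟩ := exists_Ioo_right hp h hJ
    exact ⟨fst p, b, (fst_mem p).1, hb, h1, fun x hx => H x hx.1 hx.2⟩

lemma not_countable_of_mem_nhds {p : DoubleArrow} {J : Set DoubleArrow} (hJ : J ∈ 𝓝 p) :
    ¬ {r | lo r ∈ J ∧ hi r ∈ J}.Countable := by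
  obtain ⟨a, b, h0, hab, h1, H⟩ := exists_Ioo_of_mem_nhds hJ
  intro hc
  refine Cardinal.Real.Ioo_countable_iff.not.2 (not_le.2 hab)
    ((hc.image Subtype.val).mono fun r hr => ?_)
  exact ⟨⟨r, h0.trans_lt hr.1, hr.2.trans_le h1⟩, ⟨H _ hr, H _ hr⟩, rfl⟩

/-! ### Jumps of continuous functions -/

/-- For fixed `q`, no jump over `q` is a limit of such jumps from the right, so there are only
countably many of them. -/
lemma countable_jumps_over {J : Set DoubleArrow} (hJ : IsOpen J) {g : DoubleArrow → ℝ}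
    (hg : ContinuousOn g J) (q : ℝ) :
    {r | hi r ∈ J ∧ g (lo r) < q ∧ q < g (hi r)}.Countable := by
  refine (countable_setOfPred_isolated_right_within
    (s := {r | hi r ∈ J ∧ g (lo r) < q ∧ q < g (hi r)})).mono ?_
  intro r hr
  refine mem_ofPred_eq ▸ ⟨hr, ?_⟩
  have hn : {x | q < g x} ∈ 𝓝 (hi r) :=
    (hg.continuousAt (hJ.mem_nhds hr.1)).eventually (lt_mem_nhds hr.2.2)
  obtain ⟨b, hb, -, H⟩ := exists_Ioo_right (idx_hi r) r.2.2 hn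
  rw [← empty_mem_iff_bot, mem_nhdsWithin_iff_eventually]
  filter_upwards [continuousAt_subtype_val.eventually (gt_mem_nhds hb)] with t htb ht
  exact ht.1.2.1.not_gt (H (lo t) ht.2 htb)

/-- A continuous real function on an open set identifies `lo r` and `hi r` for all but countably
many `r`. -/
lemma countable_jumps {J : Set DoubleArrow} (hJ : IsOpen J) {g : DoubleArrow → ℝ}
    (hg : ContinuousOn g J) : {r | hi r ∈ J ∧ g (lo r) ≠ g (hi r)}.Countable := by
  refine ((countable_iUnion fun q : ℚ => countable_jumps_over hJ hg q).union
    (countable_iUnion fun q : ℚ => countable_jumps_over hJ hg.neg q)).mono ?_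
  rintro r ⟨hr, hne⟩
  rcases hne.lt_or_gt with h | h
  · obtain ⟨q, h1, h2⟩ := exists_rat_btwn h
    exact Or.inl (mem_iUnion.2 ⟨q, hr, h1, h2⟩)
  · obtain ⟨q, h1, h2⟩ := exists_rat_btwn (neg_lt_neg h)
    exact Or.inr (mem_iUnion.2 ⟨q, hr, h1, h2⟩)

/-! ### Injections of products into the double arrow space -/

/-- If `P c` and `Q c` lie above the same real and converge to the two points above some real, then
they are eventually constant. -/
lemma eventually_eq_of_fst_eq {C : Type*} [TopologicalSpace C] {d : C} {P Q : C → DoubleArrow}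
    (hP : ContinuousAt P d) (hQ : ContinuousAt Q d) (h : ∀ᶠ c in 𝓝 d, fst (P c) = fst (Q c))
    (hd : P d < Q d) : ∀ᶠ c in 𝓝 d, P c = P d ∧ Q c = Q d := by
  have hdd := h.self_of_nhds
  have hcov := covBy_of_fst_eq hdd hd
  filter_upwards [h, hP.eventually (gt_mem_nhds hd), hQ.eventually (lt_mem_nhds hd)]
    with c hc h1 h2
  have h1 : P c ≤ P d := hcov.le_of_lt h1
  have h2 : Q d ≤ Q c := hcov.ge_of_gt h2
  have h3 := monotone_fst h1
  have h4 := monotone_fst h2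
  obtain ⟨i0, i1⟩ := idx_of_fst_eq_of_lt hdd hd
  obtain ⟨j0, j1⟩ := idx_of_fst_eq_of_lt hc (h1.trans_lt (hd.trans_le h2))
  exact ⟨eq_of_fst_of_idx (by linarith) (j0.trans i0.symm),
    eq_of_fst_of_idx (by linarith) (j1.trans i1.symm)⟩

/-- No neighbourhood of a point over a non-isolated point of a countable space `C` is mapped
continuously and injectively from `C × 𝔸` to `𝔸`. -/
theorem not_injOn_nhds {C : Type*} [TopologicalSpace C] [Countable C] {d : C}
    (hd : ¬ IsOpen {d}) {y : DoubleArrow} {W : Set (C × DoubleArrow)} (hW : IsOpen W)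
    (hy : (d, y) ∈ W) {φ : C × DoubleArrow → DoubleArrow} (hφ : ContinuousOn φ W) :
    ¬ InjOn φ W := by
  intro hinj
  have hslice (c : C) : IsOpen {x | (c, x) ∈ W} := hW.preimage (by fun_prop)
  have hbad : (⋃ c : C, {r | (c, hi r) ∈ W ∧ fst (φ (c, lo r)) ≠ fst (φ (c, hi r))}).Countable :=
    countable_iUnion fun c => countable_jumps (hslice c) (g := fun x => fst (φ (c, x)))
      (continuous_fst.comp_continuousOn (hφ.comp (by fun_prop) fun x hx => hx))
  obtain ⟨r, ⟨hlo, hhi⟩, hr⟩ : ∃ r, (lo r ∈ {x | (d, x) ∈ W} ∧ hi r ∈ {x | (d, x) ∈ W}) ∧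
      r ∉ ⋃ c : C, {r | (c, hi r) ∈ W ∧ fst (φ (c, lo r)) ≠ fst (φ (c, hi r))} := by
    by_contra! hcon
    exact not_countable_of_mem_nhds ((hslice d).mem_nhds hy) (hbad.mono hcon)
  have hcont (x : DoubleArrow) (hx : (d, x) ∈ W) : ContinuousAt (fun c => φ (c, x)) d :=
    ContinuousAt.comp (f := fun c => (c, x)) (hφ.continuousAt (hW.mem_nhds hx)) (by fun_prop)
  have hmem (x : DoubleArrow) (hx : (d, x) ∈ W) : ∀ᶠ c in 𝓝 d, (c, x) ∈ W :=
    (hW.preimage (by fun_prop : Continuous fun c : C => (c, x))).mem_nhds hx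
  have heq : ∀ᶠ c in 𝓝 d, fst (φ (c, lo r)) = fst (φ (c, hi r)) := by
    filter_upwards [hmem _ hhi] with c hc
    by_contra h
    exact hr (mem_iUnion.2 ⟨c, hc, h⟩)
  have hne : φ (d, lo r) ≠ φ (d, hi r) := fun h =>
    (lo_lt_hi r).ne (congrArg Prod.snd (hinj hlo hhi h))
  have hconst : ∀ᶠ c in 𝓝 d, φ (c, lo r) = φ (d, lo r) := by
    rcases hne.lt_or_gt with h | h
    · exact (eventually_eq_of_fst_eq (hcont _ hlo) (hcont _ hhi) heq h).mono fun c hc => hc.1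
    · exact (eventually_eq_of_fst_eq (hcont _ hhi) (hcont _ hlo)
        (heq.mono fun c hc => hc.symm) h).mono fun c hc => hc.2
  refine hd (isOpen_singleton_iff_nhds_eq_pure d |>.2 (le_antisymm ?_ (pure_le_nhds d)))
  rw [le_pure_iff]
  filter_upwards [hconst, hmem _ hlo] with c hc hcW
  exact congrArg Prod.fst (hinj hcW hlo hc)

/-- Homeomorphisms of `C × 𝔸` preserve the set of points over isolated points of `C`. -/
lemma isOpen_singleton_of_homeomorph {C : Type*} [TopologicalSpace C] [Countable C]
    (h : C × DoubleArrow ≃ₜ C × DoubleArrow) {p : C × DoubleArrow} (hp : IsOpen {p.1}) :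
    IsOpen {(h p).1} := by
  by_contra hd
  -- `W` is the image of `{p.1} × 𝔸`; on it the second coordinate of `h.symm` is injective.
  refine not_injOn_nhds hd (y := (h p).2) (W := {z | (h.symm z).1 ∈ ({p.1} : Set C)})
    (hp.preimage (by fun_prop)) (by simp) (φ := fun z => (h.symm z).2) (by fun_prop) ?_
  intro a ha b hb hab
  exact h.symm.injective (Prod.ext (Eq.trans ha (Eq.symm hb)) hab)

end DoubleArrow

/-! ### Products with countable spaces -/

/-- The complements of the non-isolated points are countably many dense open sets, so Baire's
theorem applies to their intersection. -/
lemma dense_setOf_isOpen_singleton (C : Type*) [TopologicalSpace C] [T1Space C] [BaireSpace C]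
    [Countable C] : Dense {c : C | IsOpen {c}} := by
  have h := dense_iInter_of_isOpen (f := fun c : {c : C // ¬ IsOpen {c}} => ({c.1}ᶜ : Set C))
    (fun c => isOpen_compl_singleton)
    (fun c => dense_compl_singleton_iff_not_open.2 c.2)
  refine h.mono fun x hx => ?_
  by_contra hxo
  exact mem_iInter.1 hx ⟨x, hxo⟩ rfl

open DoubleArrow in
theorem mainTheorem9 :
    (¬ ∃ S : Set DoubleArrow, Nonempty (S ≃ₜ DoubleArrow × OmegaPlusOne)) ∧
    (∀ (C : Type*) [TopologicalSpace C] [T2Space C] [CompactSpace C] [Countable C] [Infinite C],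
      ¬ IsHomogeneous (C × DoubleArrow) ∧ ¬ IsCDH (C × DoubleArrow)) := by
  refine ⟨?_, ?_⟩
  · rintro ⟨S, ⟨e⟩⟩
    have htop : ¬ IsOpen ({⊤} : Set ℕ∞) := by
      intro h
      obtain ⟨l, hl, hsub⟩ := exists_Ioc_subset_of_mem_nhds (h.mem_nhds rfl) ⟨0, ENat.top_pos⟩
      lift l to ℕ using hl.ne
      exact ENat.natCast_ne_top (l + 1) (hsub ⟨by exact_mod_cast l.lt_succ_self, le_top⟩)
    let r : Ioo (0 : ℝ) 1 := ⟨1 / 2, by norm_num, by norm_num⟩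
    refine not_injOn_nhds htop (y := lo r) isOpen_univ (mem_univ _)
      (φ := fun z => (e.symm z.swap : DoubleArrow)) (by fun_prop) (Function.Injective.injOn ?_)
    exact Subtype.val_injective.comp (e.symm.injective.comp Prod.swap_injective)
  · intro C _ _ _ _ _
    have hI := dense_setOf_isOpen_singleton C
    obtain ⟨c, hc⟩ : ∃ c : C, IsOpen {c} := hI.nonempty
    obtain ⟨d, hd⟩ : ∃ d : C, ¬ IsOpen {d} := by
      by_contra! hcon
      have := discreteTopology_iff_isOpen_singleton.2 hcon
      exact not_finite_iff_infinite.2 ‹_› (finite_of_compact_of_discrete (X := C))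
    let x : DoubleArrow := lo ⟨1 / 2, by norm_num, by norm_num⟩
    refine ⟨fun hom => ?_, fun cdh => ?_⟩
    · obtain ⟨h, hh⟩ := hom (c, x) (d, x)
      have := isOpen_singleton_of_homeomorph h (p := (c, x)) hc
      rw [hh] at this
      exact hd this
    · have := cdh.1
      obtain ⟨D, hDc, hD⟩ := TopologicalSpace.exists_countable_dense (C × DoubleArrow)
      have hIo : IsOpen {c : C | IsOpen {c}} := by
        rw [← biUnion_of_singleton {c : C | IsOpen {c}}]
        exact isOpen_biUnion fun c hc => hc
      have hD' : Dense (D ∩ Prod.fst ⁻¹' {c : C | IsOpen {c}}) :=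
        hD.inter_of_isOpen_right (hI.preimage isOpenMap_fst) (hIo.preimage _root_.continuous_fst)
      have hDc' := hDc.mono (inter_subset_left (t := Prod.fst ⁻¹' {c : C | IsOpen {c}}))
      obtain ⟨h, hh⟩ := cdh.2 _ (insert (d, x) _) hDc' hD' (hDc'.insert _)
        (hD'.mono (subset_insert (d, x) _))
      obtain ⟨p, hp, hpd⟩ : (d, x) ∈ h '' _ := hh ▸ mem_insert _ _
      have := isOpen_singleton_of_homeomorph h hp.2
      rw [hpd] at this
      exact hd this
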